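/- Let $n \ge 2$, let $\zeta = e^{\pi i/n}$, and let $\mathbf{D}_n \subset \mathrm{SU}_2$ be the binary dihedral group generated by $$\mathrm{x} = \begin{pmatrix} \zeta^{-1} & 0 \\ 0 & \zeta \end{pmatrix} \quad\text{and}\quad \mathrm{y} = \begin{pmatrix} 0 & i \\ i & 0 \end{pmatrix}.$$ Let $\mathrm{V} = \mathbb{C}^2$ be the natural $\mathbf{D}_n$-module of column vectors, on which $\mathbf{D}_n$ acts by matrix multiplication, and let $\mathsf{m}^0(t) = \sum_{k \ge 0} \dim\big((\mathrm{V}^{\otimes k})^{\mathbf{D}_n}\big)\, t^k$ be the Poincaré series for the $\mathbf{D}_n$-invariants in the tensor algebra $\mathsf{T}(\mathrm{V}) = \bigoplus_{k \ge 0} \mathrm{V}^{\otimes k}$, where $\mathbf{D}_n$ acts diagonally on $\mathrm{V}^{\otimes k}$ and trivially on $\mathrm{V}^{\otimes 0} = \mathbb{C}$. Let $\mathrm{T}_{m}$ denote the Chebyshev polynomials of the first kind. Then, in the field $\mathbb{C}((t))$ of formal Laurent series, $$\mathsf{m}^0(t) = \frac{2t^{n+1}\,\mathrm{T}_{n+1}\!\left(\frac{t^{-1}}{2}\right)}{(1-4t^2)\prod_{r=1}^{n-1}\left(1-2\cos\left(\frac{\pi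 r}{n}\right)t\right)} = \frac{\prod_{r=1}^{n+1}\left(1-2\cos\left(\frac{(2r-1)\pi}{2(n+1)}\right)t\right)}{(1-4t^2)\prod_{r=1}^{n-1}\left(1-2\cos\left(\frac{\pi r}{n}\right)t\right)}$$ $$= \frac{2^{-n}\sum_{r=0}^{\lfloor (n+1)/2\rfloor}\binom{n+1}{2r}(1-4t^2)^r}{(1-4t^2)\sum_{r=0}^{\lfloor (n-1)/2\rfloor}(-1)^r\binom{n-1-r}{r}t^{2r}}.$$ -/

import Mathlib

open scoped TensorProduct

/-- The representation of `G` on the tensor power `V^{⊗k}` induced by a representation `ρ` on `V`: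
`g (v₁ ⊗ ⋯ ⊗ vₖ) = g v₁ ⊗ ⋯ ⊗ g vₖ`; for `k = 0` it is the trivial action on the ground field. -/
noncomputable def tensorPowerRep {G V : Type*} [Group G] [AddCommGroup V] [Module ℂ V]
    (ρ : Representation ℂ G V) (k : ℕ) : Representation ℂ G (⨂[ℂ]^k V) where
  toFun g := PiTensorProduct.map (fun _ : Fin k => ρ g)
  map_one' := by simp [Module.End.one_eq_id]
  map_mul' g h := by simp [Module.End.mul_eq_comp, PiTensorProduct.map_comp]

/-- The Poincaré series `∑ₖ dim ((V^{⊗k})^G) tᵏ` of the `G`-invariants in the tensor algebra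
`T(V) = ⨁ₖ V^{⊗k}`, as a formal power series. -/
noncomputable def invariantPoincareSeries {G V : Type*} [Group G] [AddCommGroup V] [Module ℂ V]
    (ρ : Representation ℂ G V) : PowerSeries ℂ :=
  PowerSeries.mk fun k => (Module.finrank ℂ (tensorPowerRep ρ k).invariants : ℂ)

/-- The group `SU₂`. -/
abbrev SU2 : Type := Matrix.specialUnitaryGroup (Fin 2) ℂ

/-- The primitive `2n`-th root of unity `exp (π i / n)` (for `n ≥ 1`). -/
noncomputable def zeta2n (n : ℕ) : ℂ := Complex.exp (Real.pi * Complex.I / n)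

theorem conj_zeta2n (n : ℕ) : star (zeta2n n) = (zeta2n n)⁻¹ := by
  rw [zeta2n, ← Complex.exp_neg, Complex.star_def, ← Complex.exp_conj]
  congr 1
  simp [neg_div]

theorem zeta2n_ne_zero (n : ℕ) : zeta2n n ≠ 0 := Complex.exp_ne_zero _

/-- The matrix `x = diag (ζ⁻¹, ζ)` with `ζ = exp (π i / n)`, as an element of `SU₂`. -/
noncomputable def dihX (n : ℕ) : SU2 :=
  ⟨!![(zeta2n n)⁻¹, 0; 0, zeta2n n], by
    have h : (starRingEnd ℂ) (zeta2n n) = (zeta2n n)⁻¹ := conj_zeta2n n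
    have h0 := zeta2n_ne_zero n
    rw [Matrix.mem_specialUnitaryGroup_iff, Matrix.mem_unitaryGroup_iff]
    refine ⟨?_, by simp [Matrix.det_fin_two_of, h0]⟩
    ext i j
    fin_cases i <;> fin_cases j <;>
      simp [Matrix.mul_apply, Fin.sum_univ_two, Matrix.star_apply, h, h0]⟩

/-- The matrix `y = !![0, i; i, 0]`, as an element of `SU₂`. -/
noncomputable def dihY : SU2 :=
  ⟨!![0, Complex.I; Complex.I, 0], by
    rw [Matrix.mem_specialUnitaryGroup_iff, Matrix.mem_unitaryGroup_iff]
    refine ⟨?_, by simp [Matrix.det_fin_two_of]⟩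
    ext i j
    fin_cases i <;> fin_cases j <;>
      simp [Matrix.mul_apply, Fin.sum_univ_two, Matrix.star_apply]⟩

/-- The binary dihedral group `D_n`, the subgroup of `SU₂` generated by `x` and `y`. -/
noncomputable def binaryDihedral (n : ℕ) : Subgroup SU2 := Subgroup.closure {dihX n, dihY}

/-- The natural module `V = ℂ²` of a subgroup of `SU₂`, acting by matrix multiplication on
column vectors. -/
noncomputable def naturalRep (H : Subgroup SU2) : Representation ℂ H (Fin 2 → ℂ) where
  toFun g := Matrix.mulVecLin (g : SU2).val
  map_one' := by simp [Module.End.one_eq_id]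
  map_mul' g h := by simp [Module.End.mul_eq_comp, Matrix.mulVecLin_mul]

/-- The formal variable `t` in the field `ℂ((t))` of formal Laurent series. -/
noncomputable abbrev laurentT : LaurentSeries ℂ := HahnSeries.single 1 1

/-- A real number viewed as a constant Laurent series. -/
noncomputable abbrev constL (a : ℝ) : LaurentSeries ℂ := HahnSeries.C (a : ℂ)

/-- The Poincaré series `m⁰(t)` of the `D_n`-invariants in `T(ℂ²)`, viewed in `ℂ((t))`. -/
noncomputable def dihedralSeries (n : ℕ) : LaurentSeries ℂ :=
  HahnSeries.ofPowerSeries ℤ ℂ (invariantPoincareSeries (naturalRep (binaryDihedral n)))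

/-! The dimension of the invariants is the average of the character over the products `x ^ j` and `x
^ j * y`, `j < 2n`. On V these have traces 2cos(πj/n) and 0, and the trace on V^{⊗k} is the k-th
power. Summing geometric series, 4n·m⁰ = 2n + ∑_j 1/(1 - 2cos(πj/n)t).

Put z = t⁻¹/2, so that 1/(1 - 2ct) = z/(z - c). Apart from c = ±1, the cosines are the zeros of
U_{n-1}, each occurring twice, so the sum is a logarithmic derivative (`sum_one_div_sub_cos`), known
through (z² - 1)U'_{n-1} = nT_n - zU_{n-1}. Then T_{n+1} = zT_n - (1 - z²)U_{n-1} collects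
everything into 2t^{n+1}T_{n+1}(z) over (1 - 4t²)t^{n-1}U_{n-1}(z) (`dihedralSeries_succ_eq`). The
stated forms result from factoring T and U over their zeros, or expanding them in binomials. -/

/-- In the tensor basis, a diagonal entry is a product of diagonal entries of `f`, and a sum of such
products over all multi-indices is a product of sums. -/
theorem PiTensorProduct.trace_map_const {R M κ : Type*} [CommRing R] [AddCommGroup M] [Module R M]
    [Fintype κ] (b : Module.Basis κ R M) (f : M →ₗ[R] M) (k : ℕ) :
    LinearMap.trace R _ (PiTensorProduct.map (fun _ : Fin k => f)) = LinearMap.trace R M f ^ k := by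
  classical
  rw [LinearMap.trace_eq_matrix_trace R (Basis.piTensorProduct fun _ : Fin k => b),
    LinearMap.trace_eq_matrix_trace R b]
  simp only [Matrix.trace, Matrix.diag_apply, LinearMap.toMatrix_apply, Basis.piTensorProduct_apply,
    PiTensorProduct.map_tprod, Basis.piTensorProduct_repr_tprod_apply]
  rw [← Fintype.prod_sum (fun (_ : Fin k) i => b.repr (f (b i)) i)]
  simp

theorem Representation.apply_eq_self_of_closure {k G V : Type*} [CommRing k] [Group G]
    [AddCommGroup V] [Module k V] {s : Set G}
    (ρ : Representation k (Subgroup.closure s) V) {v : V}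
    (h : ∀ (g : G) (hg : g ∈ s), ρ ⟨g, Subgroup.subset_closure hg⟩ v = v) :
    v ∈ ρ.invariants := by
  rintro ⟨g, hg⟩
  induction hg using Subgroup.closure_induction with
  | mem g hg => exact h g hg
  | one => exact congrArg (· v) ρ.map_one
  | mul a b ha hb iha ihb =>
    have : ρ ⟨a * b, mul_mem ha hb⟩ = ρ ⟨a, ha⟩ * ρ ⟨b, hb⟩ := by rw [← map_mul]; rfl
    rw [this, Module.End.mul_apply, ihb, iha]
  | inv a ha iha =>
    have : ρ ⟨a⁻¹, inv_mem ha⟩ * ρ ⟨a, ha⟩ = 1 := by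
      rw [← map_mul, ← map_one ρ]; congr 1; ext1; simp
    conv_lhs => rw [← iha]
    rw [← Module.End.mul_apply, this, Module.End.one_apply]

/-! ### Averaging with the binary dihedral relations -/

section DihedralAverage

variable {A : Type*} [Ring A] {n : ℕ} {X Y : A}

theorem mul_geom_sum_of_pow_eq_one {m : ℕ} (hX : X ^ m = 1) :
    X * ∑ j ∈ Finset.range m, X ^ j = ∑ j ∈ Finset.range m, X ^ j := by
  -- Split the sum of m + 1 powers at its last and at its first term; both terms are 1.
  have h := Finset.sum_range_succ (fun j => X ^ j) m
  rw [Finset.sum_range_succ'] at h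
  simp only [pow_zero, hX, add_left_inj, pow_succ'] at h
  rw [Finset.mul_sum, h]

theorem geom_sum_mul_of_pow_eq_one {m : ℕ} (hX : X ^ m = 1) :
    (∑ j ∈ Finset.range m, X ^ j) * X = ∑ j ∈ Finset.range m, X ^ j := by
  have h := Finset.sum_range_succ (fun j => X ^ j) m
  rw [Finset.sum_range_succ'] at h
  simp only [pow_zero, hX, add_left_inj, pow_succ] at h
  rw [Finset.sum_mul, h]

theorem pow_mul_geom_sum_of_pow_eq_one {m : ℕ} (hX : X ^ m = 1) (i : ℕ) :
    X ^ i * ∑ j ∈ Finset.range m, X ^ j = ∑ j ∈ Finset.range m, X ^ j := by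
  induction i with
  | zero => simp
  | succ i ih => rw [pow_succ, mul_assoc, mul_geom_sum_of_pow_eq_one hX, ih]

theorem geom_sum_mul_pow_of_pow_eq_one {m : ℕ} (hX : X ^ m = 1) (i : ℕ) :
    (∑ j ∈ Finset.range m, X ^ j) * X ^ i = ∑ j ∈ Finset.range m, X ^ j := by
  induction i with
  | zero => simp
  | succ i ih => rw [pow_succ', ← mul_assoc, geom_sum_mul_of_pow_eq_one hX, ih]

theorem pow_mul_mul_pow_of_mul_mul_eq (h : X * Y * X = Y) (i : ℕ) : X ^ i * Y * X ^ i = Y := by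
  induction i with
  | zero => simp
  | succ i ih =>
    calc X ^ (i + 1) * Y * X ^ (i + 1) = X ^ i * (X * Y * X) * X ^ i := by
          rw [pow_succ (n := i)]; nth_rewrite 2 [← pow_succ]; rw [pow_succ']; simp only [mul_assoc]
      _ = Y := by rw [h, ih]

/-- If `X` and `Y` satisfy the relation `X Y X = Y`, then the geometric sum of `X` over a full
period commutes with `Y`. -/
theorem commute_geom_sum_of_mul_mul_eq (𝕜 : Type*) [Field 𝕜] [CharZero 𝕜] [Algebra 𝕜 A] {m : ℕ}
    (hm : m ≠ 0) (hX : X ^ m = 1) (h : X * Y * X = Y) :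
    Y * ∑ j ∈ Finset.range m, X ^ j = (∑ j ∈ Finset.range m, X ^ j) * Y := by
  have hl := pow_mul_geom_sum_of_pow_eq_one hX
  have hr := geom_sum_mul_pow_of_pow_eq_one hX
  set S := ∑ j ∈ Finset.range m, X ^ j with hS
  -- S Y S is evaluated twice: each power in one factor S is cancelled through the relation by the
  -- same power absorbed into the other S.
  have h1 : S * (Y * S) = (m : 𝕜) • (Y * S) := by
    have (j : ℕ) : X ^ j * (Y * S) = Y * S :=
      calc X ^ j * (Y * S) = X ^ j * (Y * (X ^ j * S)) := by rw [hl]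
        _ = X ^ j * Y * X ^ j * S := by simp only [mul_assoc]
        _ = Y * S := by rw [pow_mul_mul_pow_of_mul_mul_eq h]
    nth_rewrite 1 [hS]
    rw [Finset.sum_mul, Finset.sum_congr rfl fun j _ => this j, Finset.sum_const,
      Finset.card_range, Nat.cast_smul_eq_nsmul]
  have h2 : (S * Y) * S = (m : 𝕜) • (S * Y) := by
    have (j : ℕ) : (S * Y) * X ^ j = S * Y :=
      calc (S * Y) * X ^ j = S * X ^ j * Y * X ^ j := by rw [hr]
        _ = S * (X ^ j * Y * X ^ j) := by simp only [mul_assoc]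
        _ = S * Y := by rw [pow_mul_mul_pow_of_mul_mul_eq h]
    nth_rewrite 2 [hS]
    rw [Finset.mul_sum, Finset.sum_congr rfl fun j _ => this j, Finset.sum_const,
      Finset.card_range, Nat.cast_smul_eq_nsmul]
  rw [← mul_assoc, h2] at h1
  exact (smul_right_injective A (Nat.cast_ne_zero.2 hm : (m : 𝕜) ≠ 0) h1).symm

end DihedralAverage

/-- Averaging the character of a representation of a group generated by `x` and `y` subject to
the relations `x ^ (2 n) = 1`, `x ^ n = y ^ 2`, `x y x = y` of the binary dihedral group. -/
theorem Representation.finrank_invariants_eq_of_binaryDihedral_relations {𝕜 G V : Type*} [Field 𝕜]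
    [CharZero 𝕜] [Group G] [AddCommGroup V] [Module 𝕜 V] [FiniteDimensional 𝕜 V] {x y : G}
    (σ : Representation 𝕜 G V)
    (hgen : ∀ v : V, σ x v = v → σ y v = v → v ∈ σ.invariants) {n : ℕ} (hn : n ≠ 0)
    (hx : x ^ (2 * n) = 1) (hyy : x ^ n = y * y) (hxy : x * y * x = y) :
    (4 * n : 𝕜) * (Module.finrank 𝕜 σ.invariants : 𝕜) =
      ∑ j ∈ Finset.range (2 * n), LinearMap.trace 𝕜 V (σ (x ^ j)) +
        ∑ j ∈ Finset.range (2 * n), LinearMap.trace 𝕜 V (σ (x ^ j * y)) := by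
  have hx' : σ x ^ (2 * n) = 1 := by rw [← map_pow, hx, map_one]
  have hxy' : σ x * σ y * σ x = σ y := by rw [← map_mul, ← map_mul, hxy]
  have hyy' : σ y * σ y = σ x ^ n := by rw [← map_mul, ← map_pow, hyy]
  have hn0 : (4 * n : 𝕜) ≠ 0 := by simp [hn]
  have hYS := commute_geom_sum_of_mul_mul_eq 𝕜 (mul_ne_zero two_ne_zero hn) hx' hxy'
  have hXS := mul_geom_sum_of_pow_eq_one hx'
  have hSX := geom_sum_mul_pow_of_pow_eq_one hx' n
  set S := ∑ j ∈ Finset.range (2 * n), σ x ^ j with hS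
  -- The candidate average over the 4n products; they need not be distinct, since only the relations
  -- are used.
  have hproj : LinearMap.IsProj σ.invariants ((4 * n : 𝕜)⁻¹ • (S + S * σ y)) := by
    constructor
    · intro v
      refine Submodule.smul_mem _ _ (hgen _ ?_ ?_)
      · change (σ x * (S + S * σ y)) v = (S + S * σ y) v
        rw [mul_add, ← mul_assoc, hXS]
      · change (σ y * (S + S * σ y)) v = (S + S * σ y) v
        -- Left multiplication by Y swaps the two summands, as Y S Y = S Y² = S Xⁿ = S.
        rw [mul_add, ← mul_assoc, hYS, mul_assoc S, hyy', hSX, add_comm]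
    · intro v hv
      have hp (j : ℕ) : (σ x ^ j) v = v := by rw [← map_pow]; exact hv _
      have hSv : S v = (2 * n : 𝕜) • v := by
        rw [hS, LinearMap.sum_apply, Finset.sum_congr rfl fun j _ => hp j, Finset.sum_const,
          Finset.card_range, ← Nat.cast_smul_eq_nsmul 𝕜, Nat.cast_mul, Nat.cast_two]
      rw [LinearMap.smul_apply, LinearMap.add_apply, Module.End.mul_apply, hv y, hSv, ← add_smul,
        smul_smul, show (2 * n + 2 * n : 𝕜) = 4 * n by ring, inv_mul_cancel₀ hn0, one_smul]
  rw [← hproj.trace, map_smul, smul_eq_mul, mul_inv_cancel_left₀ hn0, map_add, hS, Finset.sum_mul,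
    map_sum, map_sum]
  simp only [map_mul, map_pow]

/-! ### Relations and characters of the matrices x and y -/

theorem zeta2n_pow_self {n : ℕ} (hn : n ≠ 0) : zeta2n n ^ n = -1 := by
  have : (n : ℂ) ≠ 0 := Nat.cast_ne_zero.2 hn
  rw [zeta2n, ← Complex.exp_nat_mul, mul_div_cancel₀ _ this, Complex.exp_pi_mul_I]

theorem zeta2n_pow_add_inv_pow (n j : ℕ) :
    (zeta2n n)⁻¹ ^ j + zeta2n n ^ j = ((2 * Real.cos (Real.pi * j / n) : ℝ) : ℂ) := by
  rw [zeta2n, ← Complex.exp_neg, ← Complex.exp_nat_mul, ← Complex.exp_nat_mul]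
  push_cast
  rw [Complex.two_cos, add_comm]
  congr 2 <;> ring

theorem coe_dihX_pow (n j : ℕ) :
    ((dihX n ^ j : SU2) : Matrix (Fin 2) (Fin 2) ℂ) =
      !![(zeta2n n)⁻¹ ^ j, 0; 0, zeta2n n ^ j] := by
  induction j with
  | zero => simp [Matrix.one_fin_two]
  | succ j ih =>
    have : (dihX n ^ (j + 1) : SU2).val = (dihX n ^ j : SU2).val * (dihX n).val := by
      rw [pow_succ]; rfl
    rw [this, ih, pow_succ, pow_succ]
    simp [dihX]

theorem dihX_pow_self {n : ℕ} (hn : n ≠ 0) : dihX n ^ n = dihY * dihY := by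
  apply Subtype.ext
  rw [coe_dihX_pow, inv_pow, zeta2n_pow_self hn]
  simp [dihY, inv_neg]

theorem dihX_pow_two_mul {n : ℕ} (hn : n ≠ 0) : dihX n ^ (2 * n) = 1 := by
  apply Subtype.ext
  rw [coe_dihX_pow, inv_pow, mul_comm, pow_mul, zeta2n_pow_self hn]
  simp [Matrix.one_fin_two]

theorem dihX_mul_dihY_mul_dihX (n : ℕ) : dihX n * dihY * dihX n = dihY := by
  apply Subtype.ext
  have := zeta2n_ne_zero n
  simp [dihX, dihY]
  field_simp
  simp

theorem trace_tensorPowerRep_naturalRep (H : Subgroup SU2) (k : ℕ) (g : H) :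
    LinearMap.trace ℂ _ (tensorPowerRep (naturalRep H) k g) =
      (Matrix.trace (g : SU2).val) ^ k := by
  refine (PiTensorProduct.trace_map_const (Pi.basisFun ℂ (Fin 2)) _ k).trans ?_
  congr 1
  exact Matrix.trace_toLin'_eq _

theorem trace_dihX_pow (n j : ℕ) :
    Matrix.trace (dihX n ^ j : SU2).val = ((2 * Real.cos (Real.pi * j / n) : ℝ) : ℂ) := by
  rw [coe_dihX_pow, Matrix.trace_fin_two_of, zeta2n_pow_add_inv_pow]

theorem trace_dihX_pow_mul_dihY (n j : ℕ) :
    Matrix.trace (dihX n ^ j * dihY : SU2).val = 0 := by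
  have : (dihX n ^ j * dihY : SU2).val = (dihX n ^ j : SU2).val * dihY.val := rfl
  rw [this, coe_dihX_pow]
  simp [dihY]

/-- The multiplicity of the trivial module in `V^{⊗k}`, by averaging the character. -/
theorem finrank_invariants_tensorPowerRep_binaryDihedral {n : ℕ} (hn : n ≠ 0) (k : ℕ) :
    (4 * n : ℂ) * (Module.finrank ℂ
        (tensorPowerRep (naturalRep (binaryDihedral n)) k).invariants : ℂ) =
      ∑ j ∈ Finset.range (2 * n), ((2 * Real.cos (Real.pi * j / n) : ℝ) : ℂ) ^ k +
        2 * n * 0 ^ k := by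
  have hx : dihX n ∈ binaryDihedral n := Subgroup.subset_closure (by simp)
  have hy : dihY ∈ binaryDihedral n := Subgroup.subset_closure (by simp)
  have : Module.Finite ℂ (⨂[ℂ]^k (Fin 2 → ℂ)) :=
    Module.Finite.of_basis (Basis.piTensorProduct fun _ : Fin k => Pi.basisFun ℂ (Fin 2))
  rw [Representation.finrank_invariants_eq_of_binaryDihedral_relations
    (x := (⟨dihX n, hx⟩ : binaryDihedral n)) (y := ⟨dihY, hy⟩)
    (tensorPowerRep (naturalRep (binaryDihedral n)) k) ?_ hn
    (Subtype.ext (dihX_pow_two_mul hn)) (Subtype.ext (dihX_pow_self hn))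
    (Subtype.ext (dihX_mul_dihY_mul_dihX n))]
  · simp only [trace_tensorPowerRep_naturalRep, Subgroup.coe_mul, Subgroup.coe_pow,
      trace_dihX_pow, trace_dihX_pow_mul_dihY]
    simp
  · intro v h1 h2
    refine Representation.apply_eq_self_of_closure
      (tensorPowerRep (naturalRep (binaryDihedral n)) k) ?_
    rintro g (rfl | rfl)
    exacts [h1, h2]

/-! ### Chebyshev polynomials: zeros, factorizations, binomial expansions -/

section Chebyshev

open Polynomial

theorem chebyshevT_real_splits (n : ℕ) : (Chebyshev.T ℝ n).Splits := by
  rw [splits_iff_card_roots, Chebyshev.roots_T_real, Finset.card_val, Finset.card_image_of_injOn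
    ((Finset.range n).nodup_map_iff_injOn.mp (Chebyshev.roots_T_real_nodup n))]
  simp

theorem chebyshevU_real_splits (n : ℕ) : (Chebyshev.U ℝ n).Splits := by
  rw [splits_iff_card_roots, Chebyshev.roots_U_real, Finset.card_val, Finset.card_image_of_injOn
    ((Finset.range n).nodup_map_iff_injOn.mp (Chebyshev.roots_U_real_nodup n))]
  simp

theorem Finset.prod_range_add_one_eq_prod_Icc {M : Type*} [CommMonoid M] (f : ℕ → M) (n : ℕ) :
    ∏ k ∈ Finset.range n, f (k + 1) = ∏ k ∈ Finset.Icc 1 n, f k := by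
  rw [Finset.range_eq_Ico, Finset.prod_Ico_add' f 0 n 1, zero_add]
  rfl

theorem Finset.sum_range_add_one_eq_sum_Icc {M : Type*} [AddCommMonoid M] (f : ℕ → M) (n : ℕ) :
    ∑ k ∈ Finset.range n, f (k + 1) = ∑ k ∈ Finset.Icc 1 n, f k := by
  rw [Finset.range_eq_Ico, Finset.sum_Ico_add' f 0 n 1, zero_add]
  rfl

variable {K : Type*} [Field K] (φ : ℝ →+* K)

/-- Zeros and leading coefficient are transported from ℝ along `φ`. The truncated exponent `n - 1`
is also right at n = 0, where T₀ = 1. -/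
theorem eval_chebyshevT_eq_prod (n : ℕ) (z : K) :
    (Chebyshev.T K n).eval z =
      2 ^ (n - 1) * ∏ r ∈ Finset.Icc 1 n, (z - φ (Real.cos ((2 * r - 1) * Real.pi / (2 * n)))) := by
  have hs := (chebyshevT_real_splits n).map φ
  rw [Chebyshev.map_T] at hs
  have hr : (Chebyshev.T K n).roots = ((Chebyshev.T ℝ n).roots).map φ := by
    rw [← Chebyshev.map_T φ]
    exact (chebyshevT_real_splits n).roots_map φ
  have hl : (Chebyshev.T K n).leadingCoeff = 2 ^ (n - 1) := by
    rw [← Chebyshev.map_T φ, leadingCoeff_map, Chebyshev.leadingCoeff_T, map_pow, map_ofNat]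
    simp
  rw [hs.eval_eq_prod_roots, hl, hr, Chebyshev.roots_T_real, Multiset.map_map,
    ← Finset.prod_range_add_one_eq_prod_Icc]
  congr 1
  refine (Finset.prod_image
    ((Finset.range n).nodup_map_iff_injOn.mp (Chebyshev.roots_T_real_nodup n))).trans ?_
  refine Finset.prod_congr rfl fun k _ => ?_
  simp only [Function.comp_apply, Nat.cast_add, Nat.cast_one]
  ring_nf

theorem roots_chebyshevU (n : ℕ) : (Chebyshev.U K n).roots =
    (Finset.Icc 1 n).val.map fun r : ℕ => φ (Real.cos (Real.pi * r / (n + 1 : ℕ))) := by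
  rw [← Chebyshev.map_U φ, (chebyshevU_real_splits n).roots_map φ, Chebyshev.roots_U_real,
    Finset.image_val_of_injOn
      ((Finset.range n).nodup_map_iff_injOn.mp (Chebyshev.roots_U_real_nodup n)),
    Multiset.map_map]
  have : Finset.Icc 1 n = (Finset.range n).map (addRightEmbedding 1) := by
    rw [Finset.range_eq_Ico, Finset.map_add_right_Ico]; rfl
  rw [this, Finset.map_val, Multiset.map_map]
  refine Multiset.map_congr rfl fun k _ => ?_
  simp [mul_comm]

theorem chebyshevU_splits (φ : ℝ →+* K) (n : ℕ) : (Chebyshev.U K n).Splits :=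
  Chebyshev.map_U φ n ▸ (chebyshevU_real_splits n).map φ

theorem eval_chebyshevU_eq_prod (n : ℕ) (z : K) :
    (Chebyshev.U K n).eval z =
      2 ^ n * ∏ r ∈ Finset.Icc 1 n, (z - φ (Real.cos (Real.pi * r / (n + 1 : ℕ)))) := by
  have hl : (Chebyshev.U K n).leadingCoeff = 2 ^ n := by
    rw [← Chebyshev.map_U φ, leadingCoeff_map, Chebyshev.leadingCoeff_U_natCast, map_pow,
      map_ofNat]
  rw [(chebyshevU_splits φ n).eval_eq_prod_roots, hl, roots_chebyshevU φ, Multiset.map_map]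
  rfl

/-- Partial fractions: the sum of `1 / (z - cos (π r / (n + 1)))` over the zeros of `U_n`. -/
theorem sum_one_div_sub_cos (n : ℕ) {z : K} (hz : (Chebyshev.U K n).eval z ≠ 0) :
    (z ^ 2 - 1) * (Chebyshev.U K n).eval z *
        ∑ r ∈ Finset.Icc 1 n, 1 / (z - φ (Real.cos (Real.pi * r / (n + 1 : ℕ)))) =
      (n + 1) * (Chebyshev.T K ((n : ℤ) + 1)).eval z - z * (Chebyshev.U K n).eval z := by
  have h := (chebyshevU_splits φ n).eval_derivative_eq_eval_mul_sum hz
  rw [roots_chebyshevU φ, Multiset.map_map] at h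
  have h' := congrArg (eval z) (Chebyshev.add_one_mul_T_eq_poly_in_U (R := K) n)
  simp only [eval_mul, eval_sub, eval_add, eval_one, eval_X, eval_pow, Int.cast_natCast,
    eval_natCast] at h'
  rw [h', h]
  change _ * _ * ∑ r ∈ Finset.Icc 1 n, _ = _ - (1 - z ^ 2) * (_ * ∑ r ∈ Finset.Icc 1 n, _) - _
  simp only [Function.comp_apply]
  ring

variable [CharZero K] {t : K}

theorem two_mul_pow_mul_eval_chebyshevT_eq_prod (ht : t ≠ 0) (n : ℕ) :
    2 * t ^ (n + 1) * (Chebyshev.T K ((n : ℤ) + 1)).eval (t⁻¹ / 2) =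
      ∏ r ∈ Finset.Icc 1 (n + 1),
        (1 - φ (2 * Real.cos ((2 * r - 1) * Real.pi / (2 * ((n : ℝ) + 1)))) * t) := by
  have h := eval_chebyshevT_eq_prod φ (n + 1) (t⁻¹ / 2)
  push_cast at h
  rw [h,
    -- One factor 2t goes to each zero c, since 2t(z - c) = 1 - 2ct.
    show ∀ a : K, 2 * t ^ (n + 1) * (2 ^ n * a) = (2 * t) ^ (n + 1) * a by intro a; ring]
  conv_lhs => rw [show n + 1 = (Finset.Icc 1 (n + 1)).card by simp, ← Finset.prod_const]
  rw [Nat.card_Icc, add_tsub_cancel_right, ← Finset.prod_mul_distrib]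
  refine Finset.prod_congr rfl fun r _ => ?_
  rw [map_mul, map_ofNat]
  field_simp

theorem pow_mul_eval_chebyshevU_eq_prod (ht : t ≠ 0) (n : ℕ) :
    t ^ n * (Chebyshev.U K n).eval (t⁻¹ / 2) =
      ∏ r ∈ Finset.Icc 1 n, (1 - φ (2 * Real.cos (Real.pi * r / (n + 1 : ℕ))) * t) := by
  rw [eval_chebyshevU_eq_prod φ,
    show ∀ a : K, t ^ n * (2 ^ n * a) = (2 * t) ^ n * a by intro a; ring]
  conv_lhs => rw [show (2 * t) ^ n = (2 * t) ^ (Finset.Icc 1 n).card by simp, ← Finset.prod_const]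
  rw [← Finset.prod_mul_distrib]
  refine Finset.prod_congr rfl fun r _ => ?_
  rw [map_mul, map_ofNat]
  field_simp

/-- The sums are the even and odd parts of (1 + √(1 - 4t²))^m. Pascal's rule couples them just as
the mixed recurrences couple T_m and U_{m-1}, because 4t²(z² - 1) = 1 - 4t². Leaving the bound N
free lets the induction shift indices. -/
theorem sum_choose_even_and_odd_eq_of_lt (ht : t ≠ 0) (m : ℕ) : ∀ N, m < N →
    ∑ r ∈ Finset.range N, (m.choose (2 * r) : K) * (1 - 4 * t ^ 2) ^ r =
        (2 * t) ^ m * (Chebyshev.T K m).eval (t⁻¹ / 2) ∧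
      2 * t * ∑ r ∈ Finset.range N, (m.choose (2 * r + 1) : K) * (1 - 4 * t ^ 2) ^ r =
        (2 * t) ^ m * (Chebyshev.U K ((m : ℤ) - 1)).eval (t⁻¹ / 2) := by
  induction m with
  | zero =>
    intro N hN
    obtain ⟨N, rfl⟩ := Nat.exists_eq_succ_of_ne_zero hN.ne'
    rw [Finset.sum_range_succ']
    simp [Nat.choose_eq_zero_of_lt]
  | succ m ih =>
    intro N hN
    obtain ⟨N, rfl⟩ := Nat.exists_eq_succ_of_ne_zero (Nat.ne_zero_of_lt hN)
    have h1 := ih (N + 1) (by omega)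
    have h2 := ih N (by omega)
    have hF : ∑ r ∈ Finset.range (N + 1), ((m + 1).choose (2 * r) : K) * (1 - 4 * t ^ 2) ^ r =
        ∑ r ∈ Finset.range (N + 1), (m.choose (2 * r) : K) * (1 - 4 * t ^ 2) ^ r +
        (1 - 4 * t ^ 2) * ∑ r ∈ Finset.range N, (m.choose (2 * r + 1) : K) * (1 - 4 * t ^ 2) ^ r := by
      rw [Finset.sum_range_succ', Finset.sum_range_succ' (fun r => (m.choose (2 * r) : K) * _),
        Finset.mul_sum, add_right_comm, ← Finset.sum_add_distrib]
      simp only [mul_add, mul_one, mul_zero, Nat.choose_zero_right, Nat.choose_succ_succ' m]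
      congr 1
      refine Finset.sum_congr rfl fun r _ => ?_
      push_cast
      ring
    have hG : ∑ r ∈ Finset.range (N + 1), ((m + 1).choose (2 * r + 1) : K) * (1 - 4 * t ^ 2) ^ r =
        ∑ r ∈ Finset.range (N + 1), (m.choose (2 * r) : K) * (1 - 4 * t ^ 2) ^ r +
        ∑ r ∈ Finset.range (N + 1), (m.choose (2 * r + 1) : K) * (1 - 4 * t ^ 2) ^ r := by
      simp only [Nat.choose_succ_succ' m, Nat.cast_add, add_mul, Finset.sum_add_distrib]
    have hT := congrArg (eval (t⁻¹ / 2)) (Chebyshev.T_eq_X_mul_T_sub_pol_U K ((m : ℤ) - 1))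
    have hU := congrArg (eval (t⁻¹ / 2)) (Chebyshev.U_eq_X_mul_U_add_T K ((m : ℤ) - 1))
    rw [show (m : ℤ) - 1 + 2 = (m + 1 : ℕ) by push_cast; ring, sub_add_cancel] at hT
    rw [sub_add_cancel] at hU
    simp only [eval_mul, eval_sub, eval_add, eval_one, eval_X, eval_pow] at hT hU
    have h2t : 2 * t ≠ 0 := mul_ne_zero two_ne_zero ht
    constructor
    · apply mul_left_cancel₀ h2t
      rw [hF, mul_add, mul_left_comm (2 * t) (1 - _), h1.1, h2.2, hT]
      field_simp
      ring
    · rw [hG, mul_add, h1.1, h1.2, Nat.cast_add_one, add_sub_cancel_right, hU]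
      field_simp
      ring

theorem sum_choose_even_eq_eval_chebyshevT (ht : t ≠ 0) (m : ℕ) :
    ∑ r ∈ Finset.range (m / 2 + 1), (m.choose (2 * r) : K) * (1 - 4 * t ^ 2) ^ r =
      (2 * t) ^ m * (Chebyshev.T K m).eval (t⁻¹ / 2) := by
  rw [← (sum_choose_even_and_odd_eq_of_lt ht m (m + 1) (by omega)).1]
  refine Finset.sum_subset (Finset.range_subset_range.2 (by omega)) fun r _ hr => ?_
  rw [Finset.mem_range] at hr
  rw [Nat.choose_eq_zero_of_lt (by omega), Nat.cast_zero, zero_mul]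

/-- Pascal's rule along diagonals matches U_{m+2} = 2zU_{m+1} - U_m, with 2zt = 1. -/
theorem sum_choose_diag_eq_of_lt (ht : t ≠ 0) (m : ℕ) : ∀ N, m < N →
    ∑ r ∈ Finset.range N, (-1) ^ r * ((m - r).choose r : K) * t ^ (2 * r) =
      t ^ m * (Chebyshev.U K m).eval (t⁻¹ / 2) := by
  induction m using Nat.twoStepInduction with
  | zero =>
    intro N hN
    obtain ⟨N, rfl⟩ := Nat.exists_eq_succ_of_ne_zero hN.ne'
    rw [Finset.sum_range_succ']
    simp
  | one =>
    intro N hN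
    obtain ⟨N, rfl⟩ := Nat.exists_eq_succ_of_ne_zero (Nat.ne_zero_of_lt hN)
    rw [Finset.sum_range_succ']
    simp [mul_div_cancel₀, ht]
  | more m ih1 ih2 =>
    intro N hN
    obtain ⟨N, rfl⟩ := Nat.exists_eq_succ_of_ne_zero (Nat.ne_zero_of_lt hN)
    have h1 := ih1 N (by omega)
    have h2 := ih2 (N + 1) (by omega)
    have hpascal (r : ℕ) : (m + 2 - (r + 1)).choose (r + 1) =
        (m - r).choose r + (m + 1 - (r + 1)).choose (r + 1) := by
      rcases le_or_gt r m with h | h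
      · rw [show m + 2 - (r + 1) = (m - r) + 1 by omega, show m + 1 - (r + 1) = m - r by omega,
          Nat.choose_succ_succ']
      -- Beyond the diagonal the subtractions truncate to 0 and all three binomials vanish.
      · rw [show m + 2 - (r + 1) = 0 by omega, show m + 1 - (r + 1) = 0 by omega,
          show m - r = 0 by omega, Nat.choose_zero_succ, Nat.choose_eq_zero_of_lt (by omega)]
    have hH : ∑ r ∈ Finset.range (N + 1), (-1) ^ r * ((m + 2 - r).choose r : K) * t ^ (2 * r) =
        ∑ r ∈ Finset.range (N + 1), (-1) ^ r * ((m + 1 - r).choose r : K) * t ^ (2 * r) -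
        t ^ 2 * ∑ r ∈ Finset.range N, (-1) ^ r * ((m - r).choose r : K) * t ^ (2 * r) := by
      rw [Finset.sum_range_succ',
        Finset.sum_range_succ' (fun r => (-1) ^ r * ((m + 1 - r).choose r : K) * _),
        Finset.mul_sum, add_sub_right_comm, ← Finset.sum_sub_distrib]
      simp only [hpascal, Nat.choose_zero_right]
      congr 1
      refine Finset.sum_congr rfl fun r _ => ?_
      push_cast
      ring
    have hU := congrArg (eval (t⁻¹ / 2)) (Chebyshev.U_add_two K m)
    simp only [eval_mul, eval_sub, eval_ofNat, eval_X] at hU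
    rw [hH, h1, h2]
    push_cast
    rw [hU]
    field_simp
    ring

theorem sum_choose_diag_eq_eval_chebyshevU (ht : t ≠ 0) (m : ℕ) :
    ∑ r ∈ Finset.range (m / 2 + 1), (-1) ^ r * ((m - r).choose r : K) * t ^ (2 * r) =
      t ^ m * (Chebyshev.U K m).eval (t⁻¹ / 2) := by
  rw [← sum_choose_diag_eq_of_lt ht m (m + 1) (by omega)]
  refine Finset.sum_subset (Finset.range_subset_range.2 (by omega)) fun r _ hr => ?_
  rw [Finset.mem_range] at hr
  rw [Nat.choose_eq_zero_of_lt (by omega), Nat.cast_zero, mul_zero, zero_mul]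

end Chebyshev

/-! ### Summing the series in ℂ((t)) -/

/-- The reflection j ↦ 2(n + 1) - j preserves the cosine; the unpaired indices 0 and n + 1 give 1
and -1. -/
theorem sum_range_two_mul_cos {M : Type*} [AddCommMonoid M] (f : ℝ → M) (n : ℕ) :
    ∑ j ∈ Finset.range (2 * (n + 1)), f (Real.cos (Real.pi * j / (n + 1 : ℕ))) =
      f 1 + f (-1) + 2 • ∑ r ∈ Finset.Icc 1 n, f (Real.cos (Real.pi * r / (n + 1 : ℕ))) := by
  have hn : ((n : ℝ) + 1) ≠ 0 := by positivity
  rw [two_mul, Finset.sum_range_add, Finset.sum_range_succ', Finset.sum_range_succ',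
    ← Finset.sum_range_add_one_eq_sum_Icc (fun r => f (Real.cos (Real.pi * r / (n + 1 : ℕ))))]
  have h : ∑ k ∈ Finset.range n, f (Real.cos (Real.pi * (n + 1 + (k + 1) : ℕ) / (n + 1 : ℕ))) =
      ∑ k ∈ Finset.range n, f (Real.cos (Real.pi * (k + 1 : ℕ) / (n + 1 : ℕ))) := by
    rw [← Finset.sum_range_reflect (fun k => f (Real.cos (Real.pi * (k + 1 : ℕ) / (n + 1 : ℕ))))]
    refine Finset.sum_congr rfl fun k hk => ?_
    have hk' : k + 1 ≤ n := Finset.mem_range.1 hk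
    rw [← Real.cos_two_pi_sub, show n - 1 - k + 1 = n - k by omega,
      Nat.cast_sub (by omega : k ≤ n)]
    congr 2
    push_cast
    field_simp
    ring
  rw [h, add_zero, Nat.cast_zero, mul_zero, zero_div, Real.cos_zero,
    mul_div_cancel_right₀ _ (by exact_mod_cast hn : ((n + 1 : ℕ) : ℝ) ≠ 0), Real.cos_pi, two_nsmul]
  abel

/-- The inclusion of the real numbers as constants in the field of Laurent series. -/
noncomputable def realToLaurent : ℝ →+* LaurentSeries ℂ :=
  HahnSeries.C.comp Complex.ofRealHom

theorem realToLaurent_apply (a : ℝ) : realToLaurent a = constL a := rfl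

instance instCharZeroLaurentSeries : CharZero (LaurentSeries ℂ) :=
  charZero_of_injective_ringHom realToLaurent.injective

theorem laurentT_ne_zero : laurentT ≠ 0 := HahnSeries.single_ne_zero one_ne_zero

theorem one_sub_C_mul_laurentT_ne_zero (a : ℂ) :
    (1 : LaurentSeries ℂ) - HahnSeries.C a * laurentT ≠ 0 := by
  have h : (1 : LaurentSeries ℂ) - HahnSeries.C a * laurentT =
      HahnSeries.ofPowerSeries ℤ ℂ (1 - PowerSeries.C a * PowerSeries.X) := by
    simp
  rw [h, Ne, map_eq_zero_iff _ HahnSeries.ofPowerSeries_injective]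
  intro h0
  simpa using congrArg PowerSeries.constantCoeff h0

theorem ofPowerSeries_mk_pow (a : ℂ) :
    HahnSeries.ofPowerSeries ℤ ℂ (PowerSeries.mk fun k => a ^ k) =
      1 / (1 - HahnSeries.C a * laurentT) := by
  rw [eq_div_iff (one_sub_C_mul_laurentT_ne_zero a)]
  have h : (PowerSeries.mk fun k => a ^ k) * (1 - PowerSeries.C a * PowerSeries.X) = 1 := by
    ext k
    rw [mul_sub, mul_one, mul_left_comm, ← mul_assoc]
    cases k with
    | zero => simp
    | succ k =>
      rw [map_sub, PowerSeries.coeff_succ_mul_X]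
      simp [PowerSeries.coeff_one, pow_succ']
  simpa using congrArg (HahnSeries.ofPowerSeries ℤ ℂ) h

/-- The traceless elements `x ^ j * y` count only in degree 0, where 0⁰ = 1; hence the constant 2n.
-/
theorem four_mul_dihedralSeries {n : ℕ} (hn : n ≠ 0) :
    4 * n * dihedralSeries n = ∑ j ∈ Finset.range (2 * n),
      1 / (1 - realToLaurent (2 * Real.cos (Real.pi * j / n)) * laurentT) + 2 * n := by
  have h : (4 * n : PowerSeries ℂ) * invariantPoincareSeries (naturalRep (binaryDihedral n)) =
      ∑ j ∈ Finset.range (2 * n),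
        PowerSeries.mk (fun k => ((2 * Real.cos (Real.pi * j / n) : ℝ) : ℂ) ^ k) + 2 * n := by
    ext k
    have h4 : (4 * n : PowerSeries ℂ) = PowerSeries.C (4 * n : ℂ) := by
      rw [map_mul, map_natCast, map_ofNat]
    have h2 : (2 * n : PowerSeries ℂ) = PowerSeries.C (2 * n : ℂ) := by
      rw [map_mul, map_natCast, map_ofNat]
    rw [h4, h2, PowerSeries.coeff_C_mul, invariantPoincareSeries, PowerSeries.coeff_mk,
      finrank_invariants_tensorPowerRep_binaryDihedral hn, map_add, map_sum, PowerSeries.coeff_C]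
    simp only [PowerSeries.coeff_mk]
    congr 1
    split_ifs with hk <;> simp [hk]
  have h' := congrArg (HahnSeries.ofPowerSeries ℤ ℂ) h
  simp only [map_add, map_sum, map_mul, map_natCast, map_ofNat, ofPowerSeries_mk_pow] at h'
  exact h'

theorem one_sub_four_mul_laurentT_sq_ne_zero : (1 : LaurentSeries ℂ) - 4 * laurentT ^ 2 ≠ 0 := by
  have h : (1 : LaurentSeries ℂ) - 4 * laurentT ^ 2 =
      (1 - HahnSeries.C 2 * laurentT) * (1 - HahnSeries.C (-2) * laurentT) := by
    rw [map_neg, map_ofNat]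
    ring
  rw [h]
  exact mul_ne_zero (one_sub_C_mul_laurentT_ne_zero _) (one_sub_C_mul_laurentT_ne_zero _)

theorem dihedralSeries_succ_eq (n : ℕ) :
    dihedralSeries (n + 1) = 2 * laurentT ^ (n + 2) *
        (Polynomial.Chebyshev.T (LaurentSeries ℂ) ((n : ℤ) + 2)).eval (laurentT⁻¹ / 2) /
      ((1 - 4 * laurentT ^ 2) *
        (laurentT ^ n * (Polynomial.Chebyshev.U (LaurentSeries ℂ) n).eval (laurentT⁻¹ / 2))) := by
  have h4 := four_mul_dihedralSeries n.succ_ne_zero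
  have hprod := pow_mul_eval_chebyshevU_eq_prod realToLaurent laurentT_ne_zero n
  have hU : (Polynomial.Chebyshev.U (LaurentSeries ℂ) n).eval (laurentT⁻¹ / 2) ≠ 0 := by
    refine right_ne_zero_of_mul (a := laurentT ^ n) ?_
    rw [hprod]
    exact Finset.prod_ne_zero_iff.2 fun r _ => one_sub_C_mul_laurentT_ne_zero _
  have hsum := sum_one_div_sub_cos realToLaurent n hU
  have hT := congrArg (Polynomial.eval (laurentT⁻¹ / 2))
    (Polynomial.Chebyshev.T_eq_X_mul_T_sub_pol_U (LaurentSeries ℂ) n)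
  simp only [Polynomial.eval_mul, Polynomial.eval_sub, Polynomial.eval_one, Polynomial.eval_X,
    Polynomial.eval_pow] at hT
  have hsq := one_sub_four_mul_laurentT_sq_ne_zero
  have h1 := one_sub_C_mul_laurentT_ne_zero 2
  have h2 := one_sub_C_mul_laurentT_ne_zero (-2)
  rw [map_neg] at h2
  rw [map_ofNat] at h1 h2
  have ht := laurentT_ne_zero
  have hterm (c : ℝ) : 1 / (1 - realToLaurent (2 * c) * laurentT) =
      laurentT⁻¹ / 2 * (1 / (laurentT⁻¹ / 2 - realToLaurent c)) := by
    rw [map_mul, map_ofNat]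
    have h2t : (2 : LaurentSeries ℂ) * laurentT ≠ 0 := mul_ne_zero two_ne_zero ht
    rw [show (1 : LaurentSeries ℂ) - 2 * realToLaurent c * laurentT =
      2 * laurentT * (laurentT⁻¹ / 2 - realToLaurent c) by field_simp,
      one_div, mul_inv, mul_inv]
    ring
  rw [sum_range_two_mul_cos (fun c => 1 / (1 - realToLaurent (2 * c) * laurentT))] at h4
  have hn : ((n : LaurentSeries ℂ) + 1) ≠ 0 := Nat.cast_add_one_ne_zero n
  rw [eq_div_iff (mul_ne_zero hsq (mul_ne_zero (pow_ne_zero _ ht) hU)), hT]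
  rw [Finset.sum_congr rfl fun r _ => hterm _, ← Finset.mul_sum] at h4
  clear hprod hT hterm
  push_cast at h4 hsum
  simp only [map_ofNat, map_neg, mul_one, mul_neg] at h4
  -- What remains is field algebra: eliminate w between the averaged series and the logarithmic
  -- derivative.
  generalize ∑ r ∈ Finset.Icc 1 n, 1 / (laurentT⁻¹ / 2 -
    realToLaurent (Real.cos (Real.pi * (r : ℝ) / ((n : ℝ) + 1)))) = w at h4 hsum
  generalize (Polynomial.Chebyshev.U (LaurentSeries ℂ) n).eval (laurentT⁻¹ / 2) = u at *
  generalize (Polynomial.Chebyshev.T (LaurentSeries ℂ) (n + 1)).eval (laurentT⁻¹ / 2) = v at *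
  generalize dihedralSeries (n + 1) = m at *
  generalize laurentT = t at *
  have h4' : 2 * (n + 1) * m * (1 - 4 * t ^ 2) = 1 + (1 - 4 * t ^ 2) * (t⁻¹ / 2 * w) + (n + 1) * (1 - 4 * t ^ 2) := by
    have : 1 / (1 - 2 * t) + 1 / (1 - -2 * t) = 2 / (1 - 4 * t ^ 2) := by
      rw [div_add_div _ _ h1 h2, show (1 - 2 * t) * (1 - -2 * t) = 1 - 4 * t ^ 2 by ring]
      congr 1
      ring
    rw [this] at h4
    have h5 := congrArg (· * (1 - 4 * t ^ 2)) h4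
    simp only [add_mul, div_mul_cancel₀ _ hsq, nsmul_eq_mul] at h5
    push_cast at h5
    linear_combination h5 / 2
  have hsum' : (1 - 4 * t ^ 2) * u * w = 4 * t ^ 2 * (n + 1) * v - 2 * t * u := by
    field_simp at hsum
    linear_combination hsum
  field_simp at h4' ⊢
  apply mul_left_cancel₀ hn
  linear_combination (t ^ (n + 1) * u / 2) * h4' + t ^ (n + 1) / 2 * hsum'

theorem theorem3p7 (n : ℕ) (hn : 2 ≤ n) :
    dihedralSeries n =
        2 * laurentT ^ (n + 1) *
            Polynomial.aeval (laurentT⁻¹ / 2) (Polynomial.Chebyshev.T ℂ ((n : ℤ) + 1)) /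
          ((1 - 4 * laurentT ^ 2) *
            ∏ r ∈ Finset.Icc 1 (n - 1),
              (1 - constL (2 * Real.cos (Real.pi * (r : ℝ) / (n : ℝ))) * laurentT)) ∧
    dihedralSeries n =
        (∏ r ∈ Finset.Icc 1 (n + 1),
            (1 - constL (2 * Real.cos ((2 * (r : ℝ) - 1) * Real.pi / (2 * ((n : ℝ) + 1)))) *
              laurentT)) /
          ((1 - 4 * laurentT ^ 2) *
            ∏ r ∈ Finset.Icc 1 (n - 1),
              (1 - constL (2 * Real.cos (Real.pi * (r : ℝ) / (n : ℝ))) * laurentT)) ∧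
    dihedralSeries n =
        ((2 : LaurentSeries ℂ) ^ (-(n : ℤ)) *
            ∑ r ∈ Finset.range ((n + 1) / 2 + 1),
              ((n + 1).choose (2 * r) : LaurentSeries ℂ) * (1 - 4 * laurentT ^ 2) ^ r) /
          ((1 - 4 * laurentT ^ 2) *
            ∑ r ∈ Finset.range ((n - 1) / 2 + 1),
              (-1) ^ r * ((n - 1 - r).choose r : LaurentSeries ℂ) * laurentT ^ (2 * r)) := by
  obtain ⟨n, rfl⟩ : ∃ m, n = m + 1 := ⟨n - 1, by omega⟩
  have hU := pow_mul_eval_chebyshevU_eq_prod realToLaurent laurentT_ne_zero n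
  have hT := two_mul_pow_mul_eval_chebyshevT_eq_prod realToLaurent laurentT_ne_zero (n + 1)
  have hE := sum_choose_even_eq_eval_chebyshevT laurentT_ne_zero (n + 1 + 1)
  have hD := sum_choose_diag_eq_eval_chebyshevU laurentT_ne_zero n
  simp only [realToLaurent_apply] at hU hT
  have hm : dihedralSeries (n + 1) = 2 * laurentT ^ (n + 1 + 1) *
        (Polynomial.Chebyshev.T (LaurentSeries ℂ) (((n + 1 : ℕ) : ℤ) + 1)).eval (laurentT⁻¹ / 2) /
      ((1 - 4 * laurentT ^ 2) *
        (laurentT ^ n * (Polynomial.Chebyshev.U (LaurentSeries ℂ) n).eval (laurentT⁻¹ / 2))) := by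
    rw [dihedralSeries_succ_eq]
    push_cast
    rw [add_assoc (n : ℤ) 1 1]
    rfl
  rw [add_tsub_cancel_right, Polynomial.Chebyshev.aeval_T, ← hT, ← hU, hE, hD]
  refine ⟨hm, hm, ?_⟩
  rw [hm]
  congr 1
  push_cast
  -- The binomial sum carries (2t)^{n+2} where the first form has 2t^{n+2}; the power 2^{-(n+1)}
  -- makes up the difference.
  rw [zpow_neg, ← Nat.cast_add_one, zpow_natCast, mul_pow, pow_succ 2 (n + 1)]
  field_simp
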